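/- **Setting.** There are $n\ge 1$ bidders. Bidder $i$ has a private signal $s_i\in S_i$, where $S_i$ is a (partially) ordered set with least element $0$; a private monotone valuation $v_i:\mathbf S=S_1\times\dots\times S_n\to\mathbb R_{\ge 0}$; and a private number $d_i\in\mathbb N$ such that $v_i$ is $d_i$-critical, i.e. $|\{j: v_i(\mathbf s_{-j},0_j)<v_i(\mathbf s)\}|\le d_i$ for every $\mathbf s\in\mathbf S$. The sets of bidders that can be served simultaneously are the independent sets $\mathcal I$ of a matroid $M$ on $[n]$. A mechanism asks every bidder $i$ for a report $(\hat s_i,\hat v_i,\hat d_i)$ with $\hat v_i:\mathbf S\to\mathbb R_{\ge0}$; it then serves a random set of bidders and charges payments $p_i$. Let $x_i$ be the probability that $i$ is served. The mechanism is *EPIC-IR* if for all signals, monotone valuations and numbers $(\mathbf s,\mathbf v,\mathbf d)$ with each $v_i$ being $d_i$-critical, and every bidder $i$, the expected utility $x_i\cdot v_i(\mathbf s)-p_i$ under truthful reports is nonnegative, and $i$ cannot increase it by any misreport $(s_i',v_i',d_i')$ of its own while the other bidders report truthfully. **Mechanism.** Given reports $(\mathbf s,\mathbf v,\mathbf d)$: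 1. For a bidder $i$ and $t\ge 0$, let $w_{i,t}(i)=t$ and $w_{i,t}(j)=v_j(\mathbf s_{-i},0_i)$ for $j\ne i$, and let $G_i(t)$ be the output of the greedy algorithm for $M$ with weights $w_{i,t}$ (scan the bidders by decreasing weight, ties in favor of lower indices, and add a bidder whenever the set stays independent). Bidder $i$ is a *candidate* if $i\in G_i(v_i(\mathbf s))$. Let $\mathcal C$ be the set of candidates. 2. Let $\bar d^i=\max_{j\ne i}d_j$ (with $\max\emptyset=0$), let $\bar d=\max_j d_j$, and let $\tilde i$ be the bidder with the largest $d_i$ (the lowest index in case of ties). Then $\bar d^i=\bar d$ for all $i\neq\tilde i$. 3. Choose a partition of $\mathcal C\setminus\{\tilde i\}$ into $\bar d+1$ (possibly empty) independent sets. If none exists, serve nobody and charge nothing. Otherwise flip a fair coin. On heads, if $\tilde i\in\mathcal C$, serve $\{\tilde i\}$ with probability $1/(\bar d^{\tilde i}+1)$, and otherwise serve nobody. On tails, serve one of the $\bar d+1$ sets of the partition, chosen uniformly at random. 4. Bidder $i$ pays $p_i=x_i\,v_i(\mathbf s)-\int_0^{v_i(\mathbf s)}x_i(t)\,dt$, where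 $x_i(t)=\frac1{2(\bar d^i+1)}$ if $i\in G_i(t)$ and $x_i(t)=0$ otherwise. **Theorem.** For every matroid $M$ on $[n]$, the mechanism serves only independent sets, charges nonnegative payments (both for arbitrary reports), and is EPIC-IR. Moreover, for all $(\mathbf s,\mathbf v,\mathbf d)$ with each $v_i$ monotone and $d_i$-critical, under truthful reports the partition in step 3 exists, bidder $i$ is served with probability exactly $x_i=x_i(v_i(\mathbf s))$, and the expected welfare is a $2(\max_i d_i+1)$-approximation to the optimum: $$\max_{I\in\mathcal I}\sum_{i\in I}v_i(\mathbf s)\;\le\;2\bigl(\max_i d_i+1\bigr)\cdot\sum_{i=1}^n x_i\,v_i(\mathbf s).$$ -/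

import Mathlib

open scoped NNReal

namespace InterdependentAuction

/-- A nonnegative valuation, depending on the signals of all bidders. Bidder `j`'s signal space is
`S j`; its least signal (the signal `0`) is `⊥`. -/
abbrev Valuation {n : ℕ} (S : Fin n → Type*) := (∀ j, S j) → ℝ≥0

/-- `v` is `k`-critical: at every signal profile, zeroing out the signal of `j` strictly lowers the
value for at most `k` bidders `j`. -/
def IsCritical {n : ℕ} {S : Fin n → Type*} [∀ j, PartialOrder (S j)] [∀ j, OrderBot (S j)]
    (k : ℕ) (v : Valuation S) : Prop :=
  ∀ s : ∀ j, S j, (Finset.univ.filter fun j => v (Function.update s j ⊥) < v s).card ≤ k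

/-- The true types of the bidders: every valuation is monotone, and `v i` is `d i`-critical. -/
def IsTypeProfile {n : ℕ} {S : Fin n → Type*} [∀ j, PartialOrder (S j)] [∀ j, OrderBot (S j)]
    (v : Fin n → Valuation S) (d : Fin n → ℕ) : Prop :=
  ∀ i, Monotone (v i) ∧ IsCritical (d i) (v i)

/-! ### Mechanisms -/

/-- A randomized direct mechanism. Each bidder `i` reports a signal `s i`, a valuation `v i` and a
number `d i`; the mechanism draws a random set of served bidders and charges payments. Every
combination of reports is allowed. -/
structure Mechanism {n : ℕ} (S : Fin n → Type*) where
  /-- the distribution of the set of served bidders -/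
  outcome : (∀ j, S j) → (Fin n → Valuation S) → (Fin n → ℕ) → PMF (Finset (Fin n))
  /-- the payment of each bidder -/
  payment : (∀ j, S j) → (Fin n → Valuation S) → (Fin n → ℕ) → Fin n → ℝ

/-- The probability that bidder `i` belongs to the random set with distribution `μ`. -/
noncomputable def servedProb {n : ℕ} (μ : PMF (Finset (Fin n))) (i : Fin n) : ℝ :=
  ∑ A with i ∈ A, (μ A).toReal

namespace Mechanism

variable {n : ℕ} {S : Fin n → Type*}

/-- The allocation rule: the probability that bidder `i` is served. -/
noncomputable def alloc (𝓜 : Mechanism S) (s : ∀ j, S j) (v : Fin n → Valuation S)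
    (d : Fin n → ℕ) (i : Fin n) : ℝ :=
  servedProb (𝓜.outcome s v d) i

/-- The expected utility of a bidder `i` whose actual value is `value`, under reports `s, v, d`. -/
noncomputable def utility (𝓜 : Mechanism S) (value : ℝ≥0) (s : ∀ j, S j)
    (v : Fin n → Valuation S) (d : Fin n → ℕ) (i : Fin n) : ℝ :=
  𝓜.alloc s v d i * value - 𝓜.payment s v d i

/-- Only sets that are independent in `M` are ever served, whatever the reports. -/
def IsFeasible (𝓜 : Mechanism S) (M : Matroid (Fin n)) : Prop :=
  ∀ s v d, ∀ A ∈ (𝓜.outcome s v d).support, M.Indep (A : Set (Fin n))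

/-- Payments are nonnegative, whatever the reports. -/
def NonnegPayments (𝓜 : Mechanism S) : Prop :=
  ∀ s v d i, 0 ≤ 𝓜.payment s v d i

variable [∀ j, PartialOrder (S j)] [∀ j, OrderBot (S j)]

/-- Ex-post incentive compatibility. The deviating bidder may misreport signal, valuation and
criticality in any way; the misreported valuation need not be critical for the misreported number. -/
def ExPostIC (𝓜 : Mechanism S) : Prop :=
  ∀ s v d, IsTypeProfile v d →
    ∀ (i : Fin n) (s' : S i) (v' : Valuation S) (d' : ℕ),
      𝓜.utility (v i s) (Function.update s i s') (Function.update v i v')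
          (Function.update d i d') i
        ≤ 𝓜.utility (v i s) s v d i

/-- Ex-post individual rationality. -/
def ExPostIR (𝓜 : Mechanism S) : Prop :=
  ∀ s v d, IsTypeProfile v d → ∀ i : Fin n, 0 ≤ 𝓜.utility (v i s) s v d i

/-- Ex-post incentive compatible and ex-post individually rational. -/
def IsEPICIR (𝓜 : Mechanism S) : Prop :=
  𝓜.ExPostIC ∧ 𝓜.ExPostIR

end Mechanism

/-- The expected welfare of the random set with distribution `μ`. -/
noncomputable def expectedWelfare {n : ℕ} {S : Fin n → Type*} (μ : PMF (Finset (Fin n)))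
    (s : ∀ j, S j) (v : Fin n → Valuation S) : ℝ :=
  ∑ A, (μ A).toReal * ∑ i ∈ A, (v i s : ℝ)

open Classical in
/-- The optimal welfare: the largest total value of an independent set. -/
noncomputable def optWelfare {n : ℕ} {S : Fin n → Type*} (M : Matroid (Fin n))
    (s : ∀ j, S j) (v : Fin n → Valuation S) : ℝ≥0 :=
  (Finset.univ.filter fun A : Finset (Fin n) => M.Indep (A : Set (Fin n))).sup
    fun A => ∑ i ∈ A, v i s

/-! ### The greedy algorithm and the candidates -/

/-- `i` is considered no later than `j`: larger weights first, ties in favor of lower indices. -/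
def Precedes {n : ℕ} (w : Fin n → ℝ) (i j : Fin n) : Prop :=
  w j < w i ∨ (w i = w j ∧ i ≤ j)

open Classical in
/-- The greedy algorithm with weights `w` on the independent sets of `M`. -/
noncomputable def greedy {n : ℕ} (M : Matroid (Fin n)) (w : Fin n → ℝ) : Finset (Fin n) :=
  ((List.finRange n).insertionSort (Precedes w)).foldl
    (fun I j => if M.Indep (insert j I : Set (Fin n)) then insert j I else I) ∅

section Mech

variable {n : ℕ} {S : Fin n → Type*} [∀ j, PartialOrder (S j)] [∀ j, OrderBot (S j)]

/-- The weights used to decide whether `i`, with value `t`, is a candidate: `t` for `i` itself, and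
the shadow values, with `i`'s signal zeroed out, for all other bidders. -/
noncomputable def candidateWeight (s : ∀ j, S j) (v : Fin n → Valuation S) (i : Fin n) (t : ℝ) :
    Fin n → ℝ :=
  fun j => if j = i then t else (v j (Function.update s i ⊥) : ℝ)

/-- The set of candidates. -/
noncomputable def candidates (M : Matroid (Fin n)) (s : ∀ j, S j) (v : Fin n → Valuation S) :
    Finset (Fin n) :=
  Finset.univ.filter fun i => i ∈ greedy M (candidateWeight s v i (v i s))

/-- The maximum number reported by the bidders other than `i` (`0` if there are none). -/
def maxOthers (d : Fin n → ℕ) (i : Fin n) : ℕ :=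
  (Finset.univ.erase i).sup d

/-- The maximum number reported by any bidder. -/
def maxAll (d : Fin n → ℕ) : ℕ :=
  Finset.univ.sup d

/-- Some bidder reports the maximum number. -/
theorem exists_max_report [NeZero n] (d : Fin n → ℕ) :
    (Finset.univ.filter fun i => ∀ j, d j ≤ d i).Nonempty := by
  obtain ⟨i, -, hi⟩ := Finset.exists_max_image Finset.univ d Finset.univ_nonempty
  exact ⟨i, by simpa using hi⟩

/-- The bidder who reports the maximum number (the one of lowest index, in case of ties). -/
def topBidder [NeZero n] (d : Fin n → ℕ) : Fin n :=
  (Finset.univ.filter fun i => ∀ j, d j ≤ d i).min' (exists_max_report d)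

/-- `P` partitions `C` into `k` pairwise disjoint independent sets. Some of them may be empty, so
this is a partition into at most `k` nonempty independent sets. -/
def IsIndepPartition (M : Matroid (Fin n)) (C : Finset (Fin n)) (k : ℕ)
    (P : Fin k → Finset (Fin n)) : Prop :=
  (∀ a, M.Indep (P a : Set (Fin n))) ∧ (∀ a b, a ≠ b → Disjoint (P a) (P b)) ∧
    Finset.univ.biUnion P = C

/-- The candidates other than the top bidder admit the partition that the mechanism uses. -/
def Partitionable [NeZero n] (M : Matroid (Fin n)) (s : ∀ j, S j) (v : Fin n → Valuation S)
    (d : Fin n → ℕ) : Prop :=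
  ∃ P : Fin (maxAll d + 1) → Finset (Fin n),
    IsIndepPartition M ((candidates M s v).erase (topBidder d)) (maxAll d + 1) P

open Classical in
/-- The random set served by the mechanism. Flip a fair coin.
* Heads: if the top bidder is a candidate, serve that bidder alone with probability
  `1 / (maxOthers d (topBidder d) + 1)`; otherwise nobody.
* Tails: remove the top bidder from the candidates, partition the others into `maxAll d + 1`
  independent sets, and serve one of these, drawn uniformly.

If the reports admit no such partition (which can happen only if some reported valuation is not
monotone or not critical for the number reported with it), nobody is served. -/
noncomputable def cpOutcome [NeZero n] (M : Matroid (Fin n)) (s : ∀ j, S j)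
    (v : Fin n → Valuation S) (d : Fin n → ℕ) : PMF (Finset (Fin n)) :=
  if h : Partitionable M s v d then
    (PMF.uniformOfFintype Bool).bind fun heads =>
      if heads then
        (PMF.uniformOfFintype (Fin (maxOthers d (topBidder d) + 1))).map fun a =>
          if a = 0 ∧ topBidder d ∈ candidates M s v then {topBidder d} else ∅
      else
        (PMF.uniformOfFintype (Fin (maxAll d + 1))).map h.choose
  else PMF.pure ∅

open Classical in
/-- The allocation probability of `i` as a function of `i`'s value `t`, given the reports of the
others: `1 / (2 (maxOthers d i + 1))` if `i` is a candidate with value `t`, and `0` otherwise. It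
depends neither on `s i` nor on `v i` nor on `d i`. -/
noncomputable def allocCurve (M : Matroid (Fin n)) (s : ∀ j, S j) (v : Fin n → Valuation S)
    (d : Fin n → ℕ) (i : Fin n) (t : ℝ) : ℝ :=
  if i ∈ greedy M (candidateWeight s v i t) then 1 / (2 * ((maxOthers d i : ℝ) + 1)) else 0

open Classical in
/-- The payment rule `x_i * v_i(s) - ∫_0^{v_i(s)} x_i(t) dt`. No payments are made if the mechanism
serves nobody for lack of a partition. -/
noncomputable def cpPayment [NeZero n] (M : Matroid (Fin n)) (s : ∀ j, S j)
    (v : Fin n → Valuation S) (d : Fin n → ℕ) (i : Fin n) : ℝ :=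
  if Partitionable M s v d then
    servedProb (cpOutcome M s v d) i * v i s - ∫ t in (0 : ℝ)..(v i s : ℝ), allocCurve M s v d i t
  else 0

/-- The Candidate Partitioning mechanism for heterogeneous and privately known criticality. -/
noncomputable def cpMechanism [NeZero n] (M : Matroid (Fin n)) : Mechanism S where
  outcome := cpOutcome M
  payment := cpPayment M

end Mech

end InterdependentAuction

/-!
Key the bidders by `(-w i, i)`, ordered lexicographically, so that the greedy algorithm scans them
by increasing key. It selects exactly the elements of the ground set that are not spanned by
elements of smaller key. Raising a bidder's own weight and lowering the others' shrinks the set of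
bidders with smaller key, so it can only help that bidder to be selected. This one monotonicity has
two consequences: the allocation curve of a bidder is nondecreasing, whence incentive compatibility
by Myerson's payment rule, and every bidder in the greedy set for the true values is a candidate,
so the candidates have at least the optimal welfare.

For the partition, say that `i` influences `j` if zeroing the signal of `i` lowers the value of `j`.
A candidate `i` is not spanned by the bidders of smaller key (for the true values) that it does not
influence. Every bidder is influenced by at most `k = max_i d_i` bidders, so colouring the bidders
by decreasing key with `k + 1` colours can keep each `j` apart from the bidders of larger key that
influence it. In a colour class of candidates no bidder is then spanned by those of smaller key,
so the class is independent. Every candidate is thus served with probability at least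
`1 / (2 (k + 1))`.
-/

namespace InterdependentAuction

/-! ### Greedy sets of matroids -/

section Matroid

variable {α β : Type*} {M : Matroid α} {key : α → β}

theorem indep_of_forall_notMem_closure_key_lt [M.Finitary] [LinearOrder β] {X : Set α}
    (hkey : Set.InjOn key X) (hX : X ⊆ M.E)
    (h : ∀ i ∈ X, i ∉ M.closure {j ∈ X | key j < key i}) : M.Indep X := by
  by_contra hdep
  obtain ⟨C, hCX, hC⟩ := ((M.not_indep_iff hX).1 hdep).exists_isCircuit_subset
  obtain ⟨i, hi, hmax⟩ := Set.exists_max_image C key hC.finite hC.nonempty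
  refine h i (hCX hi) (M.closure_subset_closure ?_ (hC.mem_closure_sdiff_singleton_of_mem hi))
  rintro j ⟨hj, hji⟩
  exact ⟨hCX hj, (hmax j hj).lt_of_ne fun heq => hji (hkey (hCX hj) (hCX hi) heq)⟩

/-- The result of the greedy algorithm on `M` when elements are scanned by increasing `key`,
described without reference to a scan: the elements of the ground set that are not spanned by
elements of smaller key. -/
def greedySet [LT β] (M : Matroid α) (key : α → β) : Set α :=
  {i | i ∈ M.E ∧ i ∉ M.closure {j | key j < key i}}

theorem closure_greedySet_key_lt [Finite α] [Preorder β] (b : β) :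
    M.closure {j ∈ greedySet M key | key j < b} = M.closure {j | key j < b} := by
  refine (M.closure_subset_closure fun j hj => hj.2).antisymm ?_
  rw [← M.closure_inter_ground]
  refine M.closure_subset_closure_of_subset_closure ?_
  have hwf : WellFounded (InvImage (· < ·) key) := Finite.wellFounded_of_trans_of_irrefl _
  rintro j ⟨hjb, hjE⟩
  induction j using hwf.induction with
  | _ j ih =>
    by_cases hj : j ∈ M.closure {k | key k < key j}
    · rw [← M.closure_inter_ground] at hj
      exact M.closure_subset_closure_of_subset_closure
        (fun k hk => ih k hk.1 (lt_trans hk.1 hjb) hk.2) hj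
    · exact M.mem_closure_of_mem' ⟨⟨hjE, hj⟩, hjb⟩ hjE

theorem exists_exchange_of_notMem_greedySet [Finite α] [Preorder β] {A : Set α}
    (hA : M.Indep A) {a : α} (haA : a ∈ A) (haG : a ∉ greedySet M key) :
    ∃ g ∈ greedySet M key, key g < key a ∧ g ∉ A \ {a} ∧ M.Indep (insert g (A \ {a})) := by
  have hspan : a ∈ M.closure {j ∈ greedySet M key | key j < key a} := by
    rw [closure_greedySet_key_lt]
    by_contra ha
    exact haG ⟨hA.subset_ground haA, ha⟩
  obtain ⟨g, ⟨hgG, hga⟩, hg⟩ :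
      ∃ g ∈ {j ∈ greedySet M key | key j < key a}, g ∉ M.closure (A \ {a}) := by
    by_contra! hsub
    exact hA.notMem_closure_sdiff_of_mem haA
      (M.closure_subset_closure_of_subset_closure hsub hspan)
  have hind : M.Indep (A \ {a}) := hA.sdiff {a}
  exact ⟨g, hgG, hga, fun h => hg (M.mem_closure_of_mem h hind.subset_ground),
    hind.insert_indep_iff.2 (Or.inl ⟨hgG.1, hg⟩)⟩

theorem sum_le_sum_of_coe_eq_greedySet [Finite α] [Preorder β] {N : Type*} [AddCommMonoid N]
    [PartialOrder N] [CanonicallyOrderedAdd N] [IsOrderedAddMonoid N] {w : α → N}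
    (hw : ∀ i j, key i < key j → w j ≤ w i) {G A : Finset α}
    (hG : (G : Set α) = greedySet M key) (hA : M.Indep (A : Set α)) :
    ∑ i ∈ A, w i ≤ ∑ i ∈ G, w i := by
  classical
  induction hcard : (A \ G).card using Nat.strong_induction_on generalizing A with
  | _ m ih =>
    by_cases hAG : A ⊆ G
    · exact Finset.sum_le_sum_of_subset hAG
    obtain ⟨a, haA, haG⟩ := Finset.not_subset.1 hAG
    obtain ⟨g, hgG, hga, hgA, hind⟩ := exists_exchange_of_notMem_greedySet (key := key) hA
      haA (by rwa [← hG, Finset.mem_coe])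
    rw [← hG, Finset.mem_coe] at hgG
    rw [← Finset.coe_erase, Finset.mem_coe] at hgA
    rw [← Finset.coe_erase, ← Finset.coe_insert] at hind
    have hfewer : (insert g (A.erase a) \ G).card < m := by
      rw [Finset.insert_sdiff_of_mem _ hgG, Finset.erase_sdiff_comm, ← hcard]
      exact Finset.card_erase_lt_of_mem (Finset.mem_sdiff.2 ⟨haA, haG⟩)
    calc ∑ i ∈ A, w i = w a + ∑ i ∈ A.erase a, w i := (Finset.add_sum_erase A w haA).symm
      _ ≤ w g + ∑ i ∈ A.erase a, w i := by gcongr; exact hw g a hga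
      _ = ∑ i ∈ insert g (A.erase a), w i := (Finset.sum_insert hgA).symm
      _ ≤ ∑ i ∈ G, w i := ih _ hfewer hind rfl

theorem closure_insert_eq_of_not_indep {I : Set α} {e : α} (hI : M.Indep I)
    (h : ¬ M.Indep (insert e I)) : M.closure (insert e I) = M.closure I := by
  by_cases he : e ∈ M.E
  · refine M.closure_insert_eq_of_mem_closure ?_
    by_contra hcl
    exact h (hI.insert_indep_iff.2 (Or.inl ⟨he, hcl⟩))
  · rw [← M.closure_inter_ground, Set.insert_inter_of_notMem he, M.closure_inter_ground]

section GreedyList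

variable [DecidableEq α]

open Classical in
/-- The greedy algorithm that scans the list `L` and adds an element whenever the set stays
independent in `M`. -/
noncomputable def greedyList (M : Matroid α) (L : List α) : Finset α :=
  L.foldl (fun I j => if M.Indep (insert j I : Set α) then insert j I else I) ∅

open Classical in
theorem greedyList_append_singleton (L : List α) (a : α) :
    greedyList M (L ++ [a]) =
      if M.Indep (insert a (greedyList M L) : Set α) then insert a (greedyList M L)
      else greedyList M L :=
  List.foldl_append

theorem greedyList_subset_toFinset (L : List α) : greedyList M L ⊆ L.toFinset := by
  induction L using List.reverseRecOn with
  | nil => simp [greedyList]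
  | append_singleton L a ih =>
    rw [greedyList_append_singleton, List.toFinset_append]
    split_ifs
    · exact Finset.insert_subset (by simp) (ih.trans Finset.subset_union_left)
    · exact ih.trans Finset.subset_union_left

theorem indep_greedyList (L : List α) : M.Indep (greedyList M L : Set α) := by
  induction L using List.reverseRecOn with
  | nil => simp [greedyList]
  | append_singleton L a ih =>
    rw [greedyList_append_singleton]
    split_ifs with h
    · rwa [Finset.coe_insert]
    · exact ih

theorem closure_greedyList (L : List α) :
    M.closure (greedyList M L : Set α) = M.closure {j | j ∈ L} := by
  induction L using List.reverseRecOn with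
  | nil => simp [greedyList]
  | append_singleton L a ih =>
    have hstep : M.closure (greedyList M (L ++ [a]) : Set α) =
        M.closure (insert a (greedyList M L : Set α)) := by
      rw [greedyList_append_singleton]
      split_ifs with h
      · rw [Finset.coe_insert]
      · exact (closure_insert_eq_of_not_indep (indep_greedyList L) h).symm
    rw [hstep, M.closure_insert_congr_right ih]
    congr 1
    ext j
    simp [or_comm]

theorem mem_greedyList_append_singleton_self {L : List α} {a : α} (ha : a ∉ L) :
    a ∈ greedyList M (L ++ [a]) ↔ a ∈ M.E ∧ a ∉ M.closure {j | j ∈ L} := by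
  have hmem : a ∉ greedyList M L := fun h => ha (by simpa using greedyList_subset_toFinset L h)
  rw [← closure_greedyList, ← Set.mem_sdiff,
    ← (indep_greedyList L).insert_indep_iff_of_notMem (by simpa using hmem),
    greedyList_append_singleton]
  split_ifs with h <;> simp [h, hmem]

theorem mem_greedyList_append_singleton_of_ne {L : List α} {a i : α} (hia : i ≠ a) :
    i ∈ greedyList M (L ++ [a]) ↔ i ∈ greedyList M L := by
  rw [greedyList_append_singleton]
  split_ifs <;> simp [hia]

theorem mem_greedyList_iff [Preorder β] {L : List α} (hL : L.Pairwise (key · < key ·)) {i : α} :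
    i ∈ greedyList M L ↔ i ∈ L ∧ i ∈ M.E ∧ i ∉ M.closure {j ∈ {j | j ∈ L} | key j < key i} := by
  induction L using List.reverseRecOn with
  | nil => simp [greedyList]
  | append_singleton L a ih =>
    obtain ⟨hL, -, hlast⟩ := List.pairwise_append.1 hL
    have hlt : ∀ j ∈ L, key j < key a := by simpa using hlast
    have ha : a ∉ L := fun h => (hlt a h).false
    rcases eq_or_ne i a with rfl | hia
    · have hprefix : {j ∈ {j | j ∈ L ++ [i]} | key j < key i} = {j | j ∈ L} := by
        ext j
        simp only [List.mem_append, List.mem_singleton, Set.mem_ofPred_eq]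
        exact ⟨fun ⟨hj, hji⟩ => hj.resolve_right fun h => (h ▸ hji).false,
          fun hj => ⟨Or.inl hj, hlt j hj⟩⟩
      rw [mem_greedyList_append_singleton_self ha, hprefix]
      simp
    · rw [mem_greedyList_append_singleton_of_ne hia, ih hL]
      simp only [List.mem_append, List.mem_singleton, hia, or_false]
      refine and_congr_right fun hi => ?_
      have hprefix : {j ∈ {j | j ∈ L ++ [a]} | key j < key i} =
          {j ∈ {j | j ∈ L} | key j < key i} := by
        ext j
        simp only [List.mem_append, List.mem_singleton, Set.mem_ofPred_eq]
        exact and_congr_left fun hji => or_iff_left fun h => ((h ▸ hji).trans (hlt i hi)).false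
      simp only [← hprefix, List.mem_append, List.mem_singleton]

theorem coe_greedyList_eq_greedySet [Preorder β] {L : List α} (hL : L.Pairwise (key · < key ·))
    (hmem : ∀ i, i ∈ L) : (greedyList M L : Set α) = greedySet M key := by
  ext i
  simp [mem_greedyList_iff hL, greedySet, hmem]

end GreedyList

theorem exists_coloring_of_card_le [Finite α] [LinearOrder β] (key : α → β) {N : α → Finset α}
    {k : ℕ} (hN : ∀ j, (N j).card ≤ k) :
    ∃ c : α → Fin (k + 1), ∀ i j, key j < key i → i ∈ N j → c j ≠ c i := by
  classical
  have := Fintype.ofFinite α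
  suffices h : ∀ s : Finset α, ∃ c : α → Fin (k + 1),
      ∀ i ∈ s, ∀ j ∈ s, key j < key i → i ∈ N j → c j ≠ c i by
    simpa using h Finset.univ
  intro s
  induction s using Finset.induction_on_min_value key with
  | empty => exact ⟨0, by simp⟩
  | insert a s ha hmin ih =>
    obtain ⟨c, hc⟩ := ih
    obtain ⟨x, -, hx⟩ : ∃ x ∈ Finset.univ, x ∉ (N a).image c := by
      refine Finset.exists_mem_notMem_of_card_lt_card ?_
      calc ((N a).image c).card ≤ k := Finset.card_image_le.trans (hN a)
        _ < (Finset.univ : Finset (Fin (k + 1))).card := by simp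
    refine ⟨Function.update c a x, fun i hi j hj hji hiN => ?_⟩
    have his : i ∈ s := by
      refine (Finset.mem_insert.1 hi).resolve_left ?_
      rintro rfl
      rcases Finset.mem_insert.1 hj with rfl | hjs
      · exact hji.false
      · exact hji.not_ge (hmin j hjs)
    rw [Function.update_of_ne (ne_of_mem_of_not_mem his ha)]
    rcases Finset.mem_insert.1 hj with rfl | hjs
    · rw [Function.update_self]
      exact fun h => hx (h ▸ Finset.mem_image_of_mem c hiN)
    · rw [Function.update_of_ne (ne_of_mem_of_not_mem hjs ha)]
      exact hc i his j hjs hji hiN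

theorem exists_indep_coloring [Finite α] [LinearOrder β] (hkey : Function.Injective key)
    {N : α → Finset α} {k : ℕ} (hN : ∀ j, (N j).card ≤ k) {C : Set α} (hCE : C ⊆ M.E)
    (hC : ∀ i ∈ C, i ∉ M.closure {j | key j < key i ∧ i ∉ N j}) :
    ∃ c : α → Fin (k + 1), ∀ a, M.Indep {i ∈ C | c i = a} := by
  obtain ⟨c, hc⟩ := exists_coloring_of_card_le key hN
  refine ⟨c, fun a => indep_of_forall_notMem_closure_key_lt hkey.injOn
    (fun i hi => hCE hi.1) ?_⟩
  rintro i ⟨hiC, hia⟩ hspan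
  refine hC i hiC (M.closure_subset_closure ?_ hspan)
  rintro j ⟨⟨-, hja⟩, hji⟩
  exact ⟨hji, fun hiN => hc i j hji hiN (hja.trans hia.symm)⟩

end Matroid

/-! ### Monotonicity of the greedy algorithm, and candidates -/

section Greedy

variable {n : ℕ} {M : Matroid (Fin n)} {w w' : Fin n → ℝ} {i j : Fin n}

/-- The key by which `Precedes w` sorts. The weight is negated because larger weights come first. -/
def scanKey (w : Fin n → ℝ) (i : Fin n) : ℝ ×ₗ Fin n :=
  toLex (-w i, i)

theorem precedes_iff_scanKey_le : Precedes w i j ↔ scanKey w i ≤ scanKey w j := by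
  simp [Precedes, scanKey, Prod.Lex.toLex_le_toLex]

theorem scanKey_injective (w : Fin n → ℝ) : Function.Injective (scanKey w) :=
  fun _ _ h => congrArg (fun x => (ofLex x).2) h

theorem scanKey_le_scanKey (h : w i ≤ w' i) : scanKey w' i ≤ scanKey w i :=
  Prod.Lex.toLex_mono ⟨neg_le_neg h, le_rfl⟩

theorem le_of_scanKey_lt (h : scanKey w i < scanKey w j) : w j ≤ w i :=
  neg_le_neg_iff.1 (Prod.Lex.monotone_fst _ _ h.le)

theorem scanKey_lt_of_le (hi : w i ≤ w' i) (hj : w' j ≤ w j)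
    (h : scanKey w' j < scanKey w' i) : scanKey w j < scanKey w i :=
  (scanKey_le_scanKey hj).trans_lt (h.trans_le (scanKey_le_scanKey hi))

instance : Std.Total (Precedes w) :=
  ⟨fun _ _ => by simpa only [precedes_iff_scanKey_le] using le_total _ _⟩

instance : IsTrans (Fin n) (Precedes w) :=
  ⟨fun _ _ _ => by simpa only [precedes_iff_scanKey_le] using le_trans⟩

theorem coe_greedy (M : Matroid (Fin n)) (w : Fin n → ℝ) :
    (greedy M w : Set (Fin n)) = greedySet M (scanKey w) := by
  classical
  set L := (List.finRange n).insertionSort (Precedes w)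
  have hperm : L.Perm (List.finRange n) := List.perm_insertionSort _ _
  have hsorted : L.Pairwise (Precedes w) := List.pairwise_insertionSort _ _
  have hnodup : L.Nodup := hperm.nodup_iff.2 (List.nodup_finRange n)
  have hstrict : L.Pairwise (scanKey w · < scanKey w ·) :=
    hsorted.imp₂ (fun _ _ hle hne =>
      (precedes_iff_scanKey_le.1 hle).lt_of_ne ((scanKey_injective w).ne hne)) hnodup
  exact coe_greedyList_eq_greedySet hstrict fun i => hperm.mem_iff.2 (List.mem_finRange i)

theorem mem_greedy_iff :
    i ∈ greedy M w ↔ i ∈ M.E ∧ i ∉ M.closure {j | scanKey w j < scanKey w i} := by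
  rw [← Finset.mem_coe, coe_greedy]
  rfl

theorem indep_greedy (M : Matroid (Fin n)) (w : Fin n → ℝ) : M.Indep (greedy M w : Set (Fin n)) :=
  indep_greedyList _

theorem mem_greedy_of_le (hi : w i ≤ w' i) (hw : ∀ j, j ≠ i → w' j ≤ w j)
    (h : i ∈ greedy M w) : i ∈ greedy M w' := by
  rw [mem_greedy_iff] at h ⊢
  refine ⟨h.1, fun hspan => h.2 (M.closure_subset_closure (fun j hji => ?_) hspan)⟩
  have hne : j ≠ i := by
    rintro rfl
    exact lt_irrefl (scanKey w' j) hji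
  exact scanKey_lt_of_le hi (hw j hne) hji

theorem sum_le_sum_greedy (M : Matroid (Fin n)) (w : Fin n → ℝ≥0) {A : Finset (Fin n)}
    (hA : M.Indep (A : Set (Fin n))) :
    ∑ i ∈ A, w i ≤ ∑ i ∈ greedy M (fun i => (w i : ℝ)), w i :=
  sum_le_sum_of_coe_eq_greedySet (fun _ _ h => NNReal.coe_le_coe.1 (le_of_scanKey_lt h))
    (coe_greedy M _) hA

end Greedy

section Candidates

variable {n : ℕ} {S : Fin n → Type*} [∀ j, PartialOrder (S j)] [∀ j, OrderBot (S j)]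
  {M : Matroid (Fin n)} {s : ∀ j, S j} {v : Fin n → Valuation S} {d : Fin n → ℕ} {i : Fin n}

theorem candidateWeight_self (t : ℝ) : candidateWeight s v i t i = t :=
  if_pos rfl

theorem candidateWeight_of_ne {j : Fin n} (hj : j ≠ i) (t : ℝ) :
    candidateWeight s v i t j = v j (Function.update s i ⊥) :=
  if_neg hj

theorem mem_candidates :
    i ∈ candidates M s v ↔ i ∈ greedy M (candidateWeight s v i (v i s)) := by
  simp [candidates]

theorem mem_ground_of_mem_candidates (hi : i ∈ candidates M s v) : i ∈ M.E :=
  (mem_greedy_iff.1 (mem_candidates.1 hi)).1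

theorem indep_singleton_of_mem_candidates (hi : i ∈ candidates M s v) :
    M.Indep ({i} : Set (Fin n)) :=
  (indep_greedy M _).subset (Set.singleton_subset_iff.2 (mem_candidates.1 hi))

theorem apply_update_bot_le {u : Valuation S} (hu : Monotone u) (s : ∀ j, S j) (i : Fin n) :
    u (Function.update s i ⊥) ≤ u s :=
  hu (update_le_self_iff.2 bot_le)

theorem greedy_subset_candidates (hv : ∀ i, Monotone (v i)) :
    greedy M (fun j => (v j s : ℝ)) ⊆ candidates M s v := by
  refine fun i hi => mem_candidates.2 (mem_greedy_of_le ?_ (fun j hj => ?_) hi)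
  · rw [candidateWeight_self]
  · rw [candidateWeight_of_ne hj, NNReal.coe_le_coe]
    exact apply_update_bot_le (hv j) s i

theorem notMem_closure_of_mem_candidates (hi : i ∈ candidates M s v) :
    i ∉ M.closure {j | scanKey (fun j => (v j s : ℝ)) j < scanKey (fun j => (v j s : ℝ)) i ∧
      i ∉ Finset.univ.filter fun l => v j (Function.update s l ⊥) < v j s} := by
  refine fun hspan => (mem_greedy_iff.1 (mem_candidates.1 hi)).2 (M.closure_subset_closure ?_ hspan)
  rintro j ⟨hji, hinfl⟩
  have hne : j ≠ i := by
    rintro rfl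
    exact lt_irrefl _ hji
  refine scanKey_lt_of_le (candidateWeight_self _).le ?_ hji
  rw [candidateWeight_of_ne hne, NNReal.coe_le_coe]
  simpa using hinfl

theorem isIndepPartition_filter_eq {C : Finset (Fin n)} {k : ℕ} {c : Fin n → Fin k}
    (hc : ∀ a, M.Indep {i | i ∈ C ∧ c i = a}) :
    IsIndepPartition M C k fun a => C.filter (c · = a) := by
  refine ⟨fun a => ?_, fun a b hab => ?_, ?_⟩
  · rw [Finset.coe_filter]
    exact hc a
  · exact Finset.disjoint_filter.2 fun i _ hia hib => hab (hia.symm.trans hib)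
  · exact Finset.biUnion_filter_eq_of_maps_to fun i _ => Finset.mem_univ (c i)

theorem exists_isIndepPartition {k : ℕ} (hk : ∀ i, IsCritical k (v i)) {C : Finset (Fin n)}
    (hC : C ⊆ candidates M s v) :
    ∃ P : Fin (k + 1) → Finset (Fin n), IsIndepPartition M C (k + 1) P := by
  obtain ⟨c, hc⟩ := exists_indep_coloring (C := (C : Set (Fin n))) (scanKey_injective _)
    (fun j => hk j s) (fun i hi => mem_ground_of_mem_candidates (hC hi))
    (fun i hi => notMem_closure_of_mem_candidates (hC hi))
  exact ⟨_, isIndepPartition_filter_eq hc⟩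

theorem optWelfare_le_sum_candidates (hv : ∀ i, Monotone (v i)) :
    optWelfare M s v ≤ ∑ i ∈ candidates M s v, v i s := by
  classical
  refine Finset.sup_le fun A hA => ?_
  calc ∑ i ∈ A, v i s ≤ ∑ i ∈ greedy M (fun i => (v i s : ℝ)), v i s :=
        sum_le_sum_greedy M (fun i => v i s) (Finset.mem_filter.1 hA).2
    _ ≤ ∑ i ∈ candidates M s v, v i s :=
        Finset.sum_le_sum_of_subset (greedy_subset_candidates hv)

end Candidates

/-! ### Reports and service probabilities -/

section Reports

variable {n : ℕ} (d : Fin n → ℕ) (i : Fin n)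

theorem le_maxAll : d i ≤ maxAll d :=
  Finset.le_sup (Finset.mem_univ i)

theorem maxOthers_le_maxAll : maxOthers d i ≤ maxAll d :=
  Finset.sup_mono (Finset.erase_subset _ _)

theorem le_topBidder [NeZero n] : d i ≤ d (topBidder d) :=
  (Finset.mem_filter.1 (Finset.min'_mem _ (exists_max_report d))).2 i

theorem maxOthers_eq_maxAll [NeZero n] {i : Fin n} (hi : i ≠ topBidder d) :
    maxOthers d i = maxAll d := by
  have htop : topBidder d ∈ Finset.univ.erase i :=
    Finset.mem_erase.2 ⟨hi.symm, Finset.mem_univ _⟩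
  exact (maxOthers_le_maxAll d i).antisymm
    (Finset.sup_le fun j _ => (le_topBidder d j).trans (Finset.le_sup htop))

theorem maxOthers_update (d' : ℕ) : maxOthers (Function.update d i d') i = maxOthers d i :=
  Finset.sup_congr rfl fun _ hj => Function.update_of_ne (Finset.ne_of_mem_erase hj) _ _

end Reports

section ServedProb

variable {n : ℕ}

theorem expectedWelfare_eq_sum_servedProb {S : Fin n → Type*} (μ : PMF (Finset (Fin n)))
    (s : ∀ j, S j) (v : Fin n → Valuation S) :
    expectedWelfare μ s v = ∑ i, servedProb μ i * v i s := by
  simp only [expectedWelfare, servedProb, Finset.sum_mul, Finset.mul_sum, Finset.sum_filter]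
  rw [Finset.sum_comm]
  exact Finset.sum_congr rfl fun A _ => by simp

theorem servedProb_pure (A : Finset (Fin n)) (i : Fin n) :
    servedProb (PMF.pure A) i = if i ∈ A then 1 else 0 := by
  classical
  rw [servedProb, Finset.sum_filter, Finset.sum_eq_single A]
  · simp
  · intro B _ hBA
    simp [PMF.pure_apply, hBA]
  · simp

theorem servedProb_bind {α : Type*} [Fintype α] (μ : PMF α) (f : α → PMF (Finset (Fin n)))
    (i : Fin n) : servedProb (μ.bind f) i = ∑ a, (μ a).toReal * servedProb (f a) i := by
  have hfin : ∀ a A, μ a * f a A ≠ ⊤ := fun a A =>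
    ENNReal.mul_ne_top (μ.apply_ne_top a) ((f a).apply_ne_top A)
  simp only [servedProb, PMF.bind_apply, tsum_fintype, Finset.mul_sum,
    ENNReal.toReal_sum fun a _ => hfin a _, ENNReal.toReal_mul]
  exact Finset.sum_comm

theorem servedProb_map_uniform {α : Type*} [Fintype α] [Nonempty α] (g : α → Finset (Fin n))
    (i : Fin n) :
    servedProb ((PMF.uniformOfFintype α).map g) i =
      ((Finset.univ.filter fun a => i ∈ g a).card : ℝ) / Fintype.card α := by
  rw [← PMF.bind_pure_comp, servedProb_bind]
  simp [servedProb_pure, div_eq_mul_inv, ← Finset.sum_filter]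

theorem servedProb_map_uniform_singleton (k : ℕ) (p : Prop) [Decidable p] (b i : Fin n) :
    servedProb ((PMF.uniformOfFintype (Fin (k + 1))).map fun a =>
        if a = 0 ∧ p then ({b} : Finset (Fin n)) else ∅) i =
      if i = b ∧ p then 1 / ((k : ℝ) + 1) else 0 := by
  rw [servedProb_map_uniform, Fintype.card_fin, Nat.cast_add_one]
  split_ifs with h
  · have hzero : (Finset.univ.filter fun a : Fin (k + 1) =>
        i ∈ if a = 0 ∧ p then ({b} : Finset (Fin n)) else ∅) = {0} := by
      ext a
      by_cases ha : a = 0 <;> simp [ha, h]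
    simp [hzero]
  · have hnone : (Finset.univ.filter fun a : Fin (k + 1) =>
        i ∈ if a = 0 ∧ p then ({b} : Finset (Fin n)) else ∅) = ∅ := by
      refine Finset.filter_false_of_mem fun a _ => ?_
      split_ifs with ha
      · simpa using fun hib => h ⟨hib, ha.2⟩
      · simp
    simp [hnone]

theorem card_filter_mem_of_isIndepPartition {M : Matroid (Fin n)} {C : Finset (Fin n)} {k : ℕ}
    {P : Fin k → Finset (Fin n)} (hP : IsIndepPartition M C k P) (i : Fin n) :
    (Finset.univ.filter fun a => i ∈ P a).card = if i ∈ C then 1 else 0 := by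
  obtain ⟨-, hdisj, rfl⟩ := hP
  split_ifs with hi
  · obtain ⟨a, -, ha⟩ := Finset.mem_biUnion.1 hi
    refine Finset.card_eq_one.2 ⟨a, Finset.eq_singleton_iff_unique_mem.2 ⟨by simpa using ha, ?_⟩⟩
    intro b hb
    by_contra hba
    exact Finset.disjoint_left.1 (hdisj b a hba) (Finset.mem_filter.1 hb).2 ha
  · simpa [Finset.filter_eq_empty_iff] using hi

theorem servedProb_map_uniform_partition {M : Matroid (Fin n)} {C : Finset (Fin n)} {k : ℕ}
    {P : Fin (k + 1) → Finset (Fin n)} (hP : IsIndepPartition M C (k + 1) P) (i : Fin n) :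
    servedProb ((PMF.uniformOfFintype (Fin (k + 1))).map P) i =
      if i ∈ C then 1 / ((k : ℝ) + 1) else 0 := by
  rw [servedProb_map_uniform, card_filter_mem_of_isIndepPartition hP, Fintype.card_fin]
  split_ifs <;> simp

end ServedProb

/-! ### Myerson payments -/

theorem mul_sub_le_integral_of_monotoneOn {f : ℝ → ℝ} {a b : ℝ}
    (hf : MonotoneOn f (Set.uIcc a b)) : f a * (b - a) ≤ ∫ t in a..b, f t := by
  rcases le_total a b with hab | hba
  · calc f a * (b - a) = ∫ _ in a..b, f a := by simp [mul_comm]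
      _ ≤ ∫ t in a..b, f t := by
        refine intervalIntegral.integral_mono_on hab (by simp) hf.intervalIntegrable fun t ht => ?_
        exact hf Set.left_mem_uIcc (Set.Icc_subset_uIcc ht) ht.1
  · have hint : ∫ t in b..a, f t ≤ ∫ _ in b..a, f a := by
      refine intervalIntegral.integral_mono_on hba hf.intervalIntegrable.symm (by simp)
        fun t ht => ?_
      exact hf (Set.Icc_subset_uIcc' ht) Set.left_mem_uIcc ht.2
    calc f a * (b - a) = -∫ _ in b..a, f a := by simp; ring
      _ ≤ -∫ t in b..a, f t := neg_le_neg hint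
      _ = ∫ t in a..b, f t := (intervalIntegral.integral_symm b a).symm

/- In Myerson's terms: with allocation curve `f` and his payments, a bidder of value `y` gains no
more by reporting the value `r` than by reporting `y`. -/
theorem mul_sub_add_integral_le_integral_of_monotone {f : ℝ → ℝ} (hf : Monotone f) (c r y : ℝ) :
    f r * (y - r) + ∫ t in c..r, f t ≤ ∫ t in c..y, f t := by
  rw [← intervalIntegral.integral_add_adjacent_intervals
    (hf.intervalIntegrable (a := c) (b := r)) (hf.intervalIntegrable (b := y)), add_comm]
  gcongr
  exact mul_sub_le_integral_of_monotoneOn (hf.monotoneOn _)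

section AllocCurve

variable {n : ℕ} {S : Fin n → Type*} [∀ j, PartialOrder (S j)] [∀ j, OrderBot (S j)]
  (M : Matroid (Fin n)) (s : ∀ j, S j) (v : Fin n → Valuation S) (d : Fin n → ℕ) (i : Fin n)

theorem allocCurve_nonneg (t : ℝ) : 0 ≤ allocCurve M s v d i t := by
  rw [allocCurve]
  split_ifs <;> positivity

theorem monotone_allocCurve : Monotone (allocCurve M s v d i) := by
  intro t u htu
  by_cases ht : i ∈ greedy M (candidateWeight s v i t)
  · have hu : i ∈ greedy M (candidateWeight s v i u) := by
      refine mem_greedy_of_le ?_ (fun j hj => ?_) ht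
      · simpa only [candidateWeight_self] using htu
      · simp only [candidateWeight_of_ne hj, le_refl]
    rw [allocCurve, allocCurve, if_pos ht, if_pos hu]
  · rw [allocCurve, if_neg ht]
    exact allocCurve_nonneg M s v d i u

theorem candidateWeight_update (s' : S i) (v' : Valuation S) :
    candidateWeight (Function.update s i s') (Function.update v i v') i =
      candidateWeight s v i := by
  ext t j
  by_cases hj : j = i <;> simp [candidateWeight, hj]

theorem allocCurve_update (s' : S i) (v' : Valuation S) (d' : ℕ) :
    allocCurve M (Function.update s i s') (Function.update v i v') (Function.update d i d') i =
      allocCurve M s v d i := by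
  ext t
  simp only [allocCurve, candidateWeight_update, maxOthers_update]

variable {M s v d i} in
theorem one_le_mul_allocCurve_of_mem_candidates (hi : i ∈ candidates M s v) :
    1 ≤ 2 * ((maxAll d : ℝ) + 1) * allocCurve M s v d i (v i s) := by
  rw [allocCurve, if_pos (mem_candidates.1 hi), mul_one_div, one_le_div (by positivity)]
  gcongr
  exact maxOthers_le_maxAll d i

end AllocCurve

/-! ### The mechanism -/

section Mechanism

variable {n : ℕ} [NeZero n] {S : Fin n → Type*} [∀ j, PartialOrder (S j)] [∀ j, OrderBot (S j)]
  {M : Matroid (Fin n)} {s : ∀ j, S j} {v : Fin n → Valuation S} {d : Fin n → ℕ}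

theorem partitionable_of_isCritical (h : ∀ i, IsCritical (d i) (v i)) : Partitionable M s v d :=
  exists_isIndepPartition (fun i s => (h i s).trans (le_maxAll d i)) (Finset.erase_subset _ _)

theorem servedProb_cpOutcome (h : Partitionable M s v d) (i : Fin n) :
    servedProb (cpOutcome M s v d) i = allocCurve M s v d i (v i s) := by
  rw [cpOutcome, dif_pos h, servedProb_bind]
  simp only [PMF.uniformOfFintype_apply, Fintype.sum_bool, if_true, Bool.false_eq_true, if_false,
    servedProb_map_uniform_singleton, servedProb_map_uniform_partition h.choose_spec,
    allocCurve, ← mem_candidates, Finset.mem_erase]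
  by_cases hc : i ∈ candidates M s v
  · rcases eq_or_ne i (topBidder d) with rfl | hi
    · simp [hc, mul_comm]
    · simp [hc, hi, maxOthers_eq_maxAll d hi, mul_comm]
  · have htop : ¬(i = topBidder d ∧ topBidder d ∈ candidates M s v) := by
      rintro ⟨rfl, htop⟩
      exact hc htop
    simp [hc, htop]

theorem utility_cpMechanism (h : Partitionable M s v d) (y : ℝ≥0) (i : Fin n) :
    (cpMechanism M : Mechanism S).utility y s v d i =
      allocCurve M s v d i (v i s) * (y - v i s) +
        ∫ t in (0 : ℝ)..(v i s : ℝ), allocCurve M s v d i t := by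
  simp only [Mechanism.utility, Mechanism.alloc, cpMechanism, cpPayment, if_pos h,
    servedProb_cpOutcome h]
  ring

theorem utility_cpMechanism_of_not_partitionable (h : ¬ Partitionable M s v d) (y : ℝ≥0)
    (i : Fin n) : (cpMechanism M : Mechanism S).utility y s v d i = 0 := by
  simp [Mechanism.utility, Mechanism.alloc, cpMechanism, cpPayment, if_neg h, cpOutcome,
    dif_neg h, servedProb_pure]

theorem isFeasible_cpMechanism (M : Matroid (Fin n)) :
    (cpMechanism M : Mechanism S).IsFeasible M := by
  intro s v d A hA
  change A ∈ (cpOutcome M s v d).support at hA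
  rw [cpOutcome] at hA
  split_ifs at hA with h
  · obtain ⟨heads, -, hcoin⟩ := (PMF.mem_support_bind_iff _ _ _).1 hA
    cases heads with
    | false =>
      obtain ⟨a, -, rfl⟩ := (PMF.mem_support_map_iff _ _ _).1 hcoin
      exact h.choose_spec.1 a
    | true =>
      obtain ⟨a, -, rfl⟩ := (PMF.mem_support_map_iff _ _ _).1 hcoin
      split_ifs with hserve
      · simpa using indep_singleton_of_mem_candidates hserve.2
      · simp
  · rw [(PMF.mem_support_pure_iff _ _).1 hA]
    simp

theorem nonnegPayments_cpMechanism (M : Matroid (Fin n)) :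
    (cpMechanism M : Mechanism S).NonnegPayments := by
  intro s v d i
  change 0 ≤ cpPayment M s v d i
  rw [cpPayment]
  split_ifs with h
  · have hzero := mul_sub_add_integral_le_integral_of_monotone (monotone_allocCurve M s v d i)
      0 (v i s) 0
    rw [intervalIntegral.integral_same] at hzero
    rw [servedProb_cpOutcome h]
    linarith
  · exact le_rfl

theorem utility_cpMechanism_self_value (h : Partitionable M s v d) (i : Fin n) :
    (cpMechanism M : Mechanism S).utility (v i s) s v d i =
      ∫ t in (0 : ℝ)..(v i s : ℝ), allocCurve M s v d i t := by
  rw [utility_cpMechanism h, sub_self, mul_zero, zero_add]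

theorem utility_cpMechanism_self_value_nonneg (h : Partitionable M s v d) (i : Fin n) :
    0 ≤ (cpMechanism M : Mechanism S).utility (v i s) s v d i := by
  rw [utility_cpMechanism_self_value h]
  exact intervalIntegral.integral_nonneg (v i s).coe_nonneg
    fun t _ => allocCurve_nonneg M s v d i t

theorem utility_cpMechanism_update_le (h : Partitionable M s v d) (i : Fin n) (s' : S i)
    (v' : Valuation S) (d' : ℕ) :
    (cpMechanism M : Mechanism S).utility (v i s) (Function.update s i s')
        (Function.update v i v') (Function.update d i d') i
      ≤ (cpMechanism M : Mechanism S).utility (v i s) s v d i := by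
  by_cases hdev : Partitionable M (Function.update s i s') (Function.update v i v')
      (Function.update d i d')
  · rw [utility_cpMechanism hdev, allocCurve_update, utility_cpMechanism_self_value h]
    exact mul_sub_add_integral_le_integral_of_monotone (monotone_allocCurve M s v d i) 0 _ _
  · rw [utility_cpMechanism_of_not_partitionable hdev]
    exact utility_cpMechanism_self_value_nonneg h i

theorem optWelfare_le_expectedWelfare (h : Partitionable M s v d) (hv : ∀ i, Monotone (v i)) :
    (optWelfare M s v : ℝ) ≤
      2 * ((maxAll d : ℝ) + 1) * expectedWelfare (cpOutcome M s v d) s v := by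
  set x : Fin n → ℝ := fun i => allocCurve M s v d i (v i s)
  have hx : ∀ i, 0 ≤ x i := fun i => allocCurve_nonneg M s v d i _
  calc (optWelfare M s v : ℝ) ≤ ∑ i ∈ candidates M s v, (v i s : ℝ) := by
        exact_mod_cast optWelfare_le_sum_candidates hv
    _ ≤ ∑ i ∈ candidates M s v, 2 * ((maxAll d : ℝ) + 1) * x i * v i s :=
        Finset.sum_le_sum fun i hi => le_mul_of_one_le_left (v i s).coe_nonneg
          (one_le_mul_allocCurve_of_mem_candidates hi)
    _ ≤ ∑ i, 2 * ((maxAll d : ℝ) + 1) * x i * v i s :=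
        Finset.sum_le_sum_of_subset_of_nonneg (Finset.subset_univ _) fun i _ _ =>
          mul_nonneg (mul_nonneg (by positivity) (hx i)) (v i s).coe_nonneg
    _ = 2 * ((maxAll d : ℝ) + 1) * expectedWelfare (cpOutcome M s v d) s v := by
        simp only [expectedWelfare_eq_sum_servedProb,
          servedProb_cpOutcome h, Finset.mul_sum, mul_assoc, x]

end Mechanism

end InterdependentAuction

open InterdependentAuction in
theorem mainTheorem3_general {n : ℕ} [NeZero n] (S : Fin n → Type*)
    [∀ j, PartialOrder (S j)] [∀ j, OrderBot (S j)] (M : Matroid (Fin n)) :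
    (cpMechanism M : Mechanism S).IsFeasible M ∧
    (cpMechanism M : Mechanism S).NonnegPayments ∧
    ∀ (s : ∀ j, S j) (v : Fin n → Valuation S) (d : Fin n → ℕ),
      (∀ i, IsCritical (d i) (v i)) →
      (∀ (i : Fin n) (s' : S i) (v' : Valuation S) (d' : ℕ),
        (cpMechanism M : Mechanism S).utility (v i s) (Function.update s i s')
            (Function.update v i v') (Function.update d i d') i
          ≤ (cpMechanism M : Mechanism S).utility (v i s) s v d i) ∧
      (∀ i, 0 ≤ (cpMechanism M : Mechanism S).utility (v i s) s v d i) ∧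
      Partitionable M s v d ∧
      (∀ i, (cpMechanism M : Mechanism S).alloc s v d i = allocCurve M s v d i (v i s)) ∧
      ((∀ i, Monotone (v i)) →
        (optWelfare M s v : ℝ) ≤
          2 * ((maxAll d : ℝ) + 1) *
            expectedWelfare ((cpMechanism M : Mechanism S).outcome s v d) s v) := by
  refine ⟨isFeasible_cpMechanism M, nonnegPayments_cpMechanism M, fun s v d hd => ?_⟩
  have hP : Partitionable M s v d := partitionable_of_isCritical hd
  exact ⟨utility_cpMechanism_update_le hP, utility_cpMechanism_self_value_nonneg hP, hP,
    servedProb_cpOutcome hP, optWelfare_le_expectedWelfare hP⟩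

open InterdependentAuction in
theorem mainTheorem3 {n : ℕ} [NeZero n] (S : Fin n → Type*)
    [∀ j, PartialOrder (S j)] [∀ j, OrderBot (S j)] (M : Matroid (Fin n)) :
    -- the mechanism serves only independent sets and charges nonnegative payments
    (cpMechanism M : Mechanism S).IsFeasible M ∧
    (cpMechanism M : Mechanism S).NonnegPayments ∧
    -- it is EPIC-IR
    (cpMechanism M : Mechanism S).IsEPICIR ∧
    ∀ (s : ∀ j, S j) (v : Fin n → Valuation S) (d : Fin n → ℕ), IsTypeProfile v d →
      -- the partition it uses exists
      Partitionable M s v d ∧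
      -- the allocation probabilities are those from which the payments are computed
      (∀ i, (cpMechanism M : Mechanism S).alloc s v d i = allocCurve M s v d i (v i s)) ∧
      -- `2 (max_i d_i + 1)`-approximation of the optimal welfare
      (optWelfare M s v : ℝ) ≤
        2 * ((maxAll d : ℝ) + 1) *
          expectedWelfare ((cpMechanism M : Mechanism S).outcome s v d) s v := by
  obtain ⟨hfeas, hpay, h⟩ := mainTheorem3_general S M
  refine ⟨hfeas, hpay, ⟨fun s v d hvd => (h s v d fun i => (hvd i).2).1,
    fun s v d hvd => (h s v d fun i => (hvd i).2).2.1⟩, fun s v d hvd => ?_⟩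
  obtain ⟨-, -, hpart, halloc, hwelfare⟩ := h s v d fun i => (hvd i).2
  exact ⟨hpart, halloc, hwelfare fun i => (hvd i).1⟩
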